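/- Fix $n,d\in\mathbb N^*$; an input is $X\in\mathbb R^{n\times d}$ (one token per row), $X_i$ is its $i$-th row, $\mathbf 1$ denotes the all-ones column vector in $\mathbb R^n$, softmax is applied to each row, and $\odot$ is the entry-wise product. **URPE attention.** For head dimension $d_H\in\mathbb N^*$ the URPE attention matrix is $$A_{\mathrm U}(X)=\mathrm{softmax}\bigl(XW_Q(XW_K+\mathbf 1c_K^\top)^\top+B(X)\bigr)\odot C ,$$ with learnable parameters $W_Q,W_K\in\mathbb R^{d\times d_H}$, $c_K\in\mathbb R^{d_H}$, a learnable Toeplitz matrix $C\in\mathbb R^{n\times n}$, and $B$ a relative positional encoding of one of the following forms (fixed once for all; the vectors $r_k,s_k,u,v$ below are row vectors): * Shaw: $b_{ij}=X_iW_Qr_{i-j}^\top$ with learnable $r_k\in\mathbb R^{d_H}$; * T5: $b_{ij}=m_{i-j}$ with learnable $m_k\in\mathbb R$; * DeBERTa: $b_{ij}=X_iW_Qr_{i-j}^\top+s_{i-j}(X_jW_K)^\top$ with learnable $r_k,s_k\in\mathbb R^{d_H}$; * Transformer-XL: $b_{ij}=X_iW_Q(\rho_{i-j}\tilde W_K)^\top+u(X_jW_K)^\top+v(\rho_{i-j}\tilde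 W_K)^\top$ with learnable $\tilde W_K\in\mathbb R^{d\times d_H}$, $u,v\in\mathbb R^{d_H}$, and arbitrary fixed row vectors $\rho_k\in\mathbb R^d$ (for example sinusoidal ones). **Transformers.** A URPE-based Transformer block with $H$ heads, head dimension $d_H$ and hidden dimension $r$ is a composition $\mathrm{FFN}\circ\mathrm{Attn}$ with $$\mathrm{Attn}(X)=X+\sum_{h=1}^H\Bigl(A^h_{\mathrm U}(X)\bigl(XW_V^h+\mathbf 1(c_V^h)^\top\bigr)W_O^h+\mathbf 1(c_O^h)^\top\Bigr),$$ $$\mathrm{FFN}(X)=X+\mathrm{ReLU}(XW_1+\mathbf 1b_1^\top)W_2+\mathbf 1b_2^\top,$$ where each $A^h_{\mathrm U}$ is a URPE attention matrix with its own parameters, $W_V^h\in\mathbb R^{d\times d_H}$, $W_O^h\in\mathbb R^{d_H\times d}$, $W_1\in\mathbb R^{d\times r}$, $W_2\in\mathbb R^{r\times d}$, and $c_V^h\in\mathbb R^{d_H}$, $c_O^h\in\mathbb R^d$, $b_1\in\mathbb R^r$, $b_2\in\mathbb R^d$ are bias vectors. Let $\Omega_{\mathrm U}^{H,d_H,r}$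 be the set of all compositions $g_L\circ\dots\circ g_1$ of $L\ge 1$ such blocks. **Proposition.** For each of the forms of $B$ above: 1. For every $d_H\in\mathbb N^*$, URPE attention satisfies * the *attentive condition*: for all $u\in\mathbb R^{d\times 1}$ and $c\in\mathbb R$ there is a choice of the parameters for which $A_{\mathrm U}(X)=\mathrm{softmax}\bigl(Xu(Xu-c\mathbf 1)^\top\bigr)$ for all $X\in\mathbb R^{n\times d}$; * the *position-aware condition*: there are a choice of the parameters and a vector $v\in\mathbb R^n$ with pairwise distinct entries such that $A_{\mathrm U}(X)\mathbf 1=v$ for all $X\in\mathbb R^{n\times d}$. 2. URPE-based Transformers are universal approximators of continuous sequence-to-sequence functions on compact domains: for every $p\in[1,\infty)$, every $\varepsilon>0$, every compact $\mathcal D\subseteq\mathbb R^{n\times d}$ and every continuous $f:\mathcal D\to\mathbb R^{n\times d}$ there is $g\in\Omega_{\mathrm U}^{2,1,4}$ with $$\Bigl(\int_{\mathcal D}\|f(X)-g(X)\|_p^p\,\mathrm dX\Bigr)^{1/p}<\varepsilon,$$ where $\|\cdot\|_p$ is the entry-wise $\ell^p$ norm. -/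

import Mathlib

open scoped ENNReal Matrix

noncomputable section

/-- Sequences of `n` tokens in `ℝ^d`, one token per row. -/
abbrev TokenSeq (n d : ℕ) : Type := Matrix (Fin n) (Fin d) ℝ

/-- Row-wise softmax. -/
def rowSoftmax {n m : ℕ} (Z : Matrix (Fin n) (Fin m) ℝ) : Matrix (Fin n) (Fin m) ℝ :=
  Matrix.of fun i j => Real.exp (Z i j) / ∑ k, Real.exp (Z i k)

/-- Entry-wise ReLU. -/
def reluMat {n m : ℕ} (Z : Matrix (Fin n) (Fin m) ℝ) : Matrix (Fin n) (Fin m) ℝ :=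
  Z.map fun t => max t 0

/-- The matrix `1 cᵀ`, all of whose rows are `c`: a bias term. -/
def biasRows (n : ℕ) {k : ℕ} (c : Fin k → ℝ) : Matrix (Fin n) (Fin k) ℝ :=
  Matrix.of fun _ j => c j

/-- An attention class: the set of all maps `X ↦ A(X)` obtained by varying the parameters of a
parametrized attention matrix. -/
abbrev AttnClass (n d : ℕ) : Type := Set (TokenSeq n d → Matrix (Fin n) (Fin n) ℝ)

/-- For all `u ∈ ℝ^{d × 1}` and `c ∈ ℝ`, some parametrization gives
`A(X) = softmax (X u (X u - c 1)ᵀ)`. -/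
def AttentiveCondition {n d : ℕ} (𝓐 : AttnClass n d) : Prop :=
  ∀ (u : Matrix (Fin d) (Fin 1) ℝ) (c : ℝ), ∃ A ∈ 𝓐, ∀ X : TokenSeq n d,
    A X = rowSoftmax ((X * u) * (X * u - biasRows n fun _ => c)ᵀ)

/-- Some parametrization gives `A(X) 1 = v` for all `X`, where the entries of `v` are distinct. -/
def PositionAwareCondition {n d : ℕ} (𝓐 : AttnClass n d) : Prop :=
  ∃ A ∈ 𝓐, ∃ v : Fin n → ℝ, Function.Injective v ∧ ∀ X : TokenSeq n d, A X *ᵥ 1 = v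

/-- Self-attention layer with skip connection and bias terms:
`X + ∑ₕ (Aʰ(X) (X W_Vʰ + 1 (c_Vʰ)ᵀ) W_Oʰ + 1 (c_Oʰ)ᵀ)`. -/
def attnLayer {n d H dH : ℕ} (A : Fin H → TokenSeq n d → Matrix (Fin n) (Fin n) ℝ)
    (WV : Fin H → Matrix (Fin d) (Fin dH) ℝ) (cV : Fin H → Fin dH → ℝ)
    (WO : Fin H → Matrix (Fin dH) (Fin d) ℝ) (cO : Fin H → Fin d → ℝ) (X : TokenSeq n d) : TokenSeq n d :=
  X + ∑ h, (A h X * (X * WV h + biasRows n (cV h)) * WO h + biasRows n (cO h))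

/-- Feed-forward layer with skip connection and bias terms:
`X + (ReLU (X W₁ + 1 b₁ᵀ) W₂ + 1 b₂ᵀ)`. -/
def ffnLayer {n d r : ℕ} (W₁ : Matrix (Fin d) (Fin r) ℝ) (b₁ : Fin r → ℝ)
    (W₂ : Matrix (Fin r) (Fin d) ℝ) (b₂ : Fin d → ℝ) (X : TokenSeq n d) : TokenSeq n d :=
  X + (reluMat (X * W₁ + biasRows n b₁) * W₂ + biasRows n b₂)

/-- Transformer blocks with `H` heads of dimension `dH`, hidden dimension `r`, and the attention
matrix of each head taken from the class `𝓐`. -/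
def TBlocks {n d : ℕ} (𝓐 : AttnClass n d) (H dH r : ℕ) : Set (TokenSeq n d → TokenSeq n d) :=
  {g | ∃ (A : Fin H → TokenSeq n d → Matrix (Fin n) (Fin n) ℝ)
      (WV : Fin H → Matrix (Fin d) (Fin dH) ℝ) (cV : Fin H → Fin dH → ℝ)
      (WO : Fin H → Matrix (Fin dH) (Fin d) ℝ) (cO : Fin H → Fin d → ℝ)
      (W₁ : Matrix (Fin d) (Fin r) ℝ) (b₁ : Fin r → ℝ)
      (W₂ : Matrix (Fin r) (Fin d) ℝ) (b₂ : Fin d → ℝ),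
      (∀ h, A h ∈ 𝓐) ∧ g = fun X => ffnLayer W₁ b₁ W₂ b₂ (attnLayer A WV cV WO cO X)}

/-- Transformers: compositions of one or more Transformer blocks. -/
def Transformers {n d : ℕ} (𝓐 : AttnClass n d) (H dH r : ℕ) : Set (TokenSeq n d → TokenSeq n d) :=
  {g | ∃ blocks : List (TokenSeq n d → TokenSeq n d), blocks ≠ [] ∧ (∀ b ∈ blocks, b ∈ TBlocks 𝓐 H dH r) ∧
      g = blocks.foldr (fun b g' => b ∘ g') id}

/-- Toeplitz matrices: the entry depends only on the diagonal. -/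
def IsToeplitz {n : ℕ} (C : Matrix (Fin n) (Fin n) ℝ) : Prop :=
  ∃ t : ℤ → ℝ, ∀ i j : Fin n, C i j = t ((i : ℤ) - (j : ℤ))

/-- The forms of relative positional encoding. In the Transformer-XL form the encoding vectors
`ρ k` are fixed, not learnable (sinusoidal in practice; here any vectors are allowed). -/
inductive RPEForm (d : ℕ) : Type
  | shaw
  | t5
  | deberta
  | transformerXL (ρ : ℤ → Fin d → ℝ)

/-- The matrix-valued maps `X ↦ B(X)` that a form of relative positional encoding yields as its
own learnable parameters vary, in a head with query and key matrices `WQ`, `WK`. Here `(X * WQ) i`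
and `(X * WK) j` are the `i`-th query and the `j`-th key. -/
def rpeClass (n : ℕ) {d : ℕ} (dH : ℕ) (WQ WK : Matrix (Fin d) (Fin dH) ℝ) :
    RPEForm d → Set (TokenSeq n d → Matrix (Fin n) (Fin n) ℝ)
  | .shaw => {B | ∃ r : ℤ → Fin dH → ℝ, ∀ X i j,
      B X i j = (X * WQ) i ⬝ᵥ r ((i : ℤ) - (j : ℤ))}
  | .t5 => {B | ∃ m : ℤ → ℝ, ∀ X i j, B X i j = m ((i : ℤ) - (j : ℤ))}
  | .deberta => {B | ∃ r s : ℤ → Fin dH → ℝ, ∀ X i j,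
      B X i j = (X * WQ) i ⬝ᵥ r ((i : ℤ) - (j : ℤ)) + s ((i : ℤ) - (j : ℤ)) ⬝ᵥ (X * WK) j}
  | .transformerXL ρ => {B | ∃ (WK' : Matrix (Fin d) (Fin dH) ℝ) (u v : Fin dH → ℝ), ∀ X i j,
      B X i j = (X * WQ) i ⬝ᵥ (ρ ((i : ℤ) - (j : ℤ)) ᵥ* WK') + u ⬝ᵥ (X * WK) j
        + v ⬝ᵥ (ρ ((i : ℤ) - (j : ℤ)) ᵥ* WK')}

/-- Universal RPE-based attention: all maps
`X ↦ softmax (X W_Q (X W_K + 1 c_Kᵀ)ᵀ + B(X)) ⊙ C` with `C` a Toeplitz matrix and `B` of the given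
form. -/
def urpeAttention (n : ℕ) {d : ℕ} (form : RPEForm d) (dH : ℕ) : AttnClass n d :=
  {A | ∃ (WQ WK : Matrix (Fin d) (Fin dH) ℝ) (cK : Fin dH → ℝ)
      (B : TokenSeq n d → Matrix (Fin n) (Fin n) ℝ) (C : Matrix (Fin n) (Fin n) ℝ),
      B ∈ rpeClass n dH WQ WK form ∧ IsToeplitz C ∧
      A = fun X => rowSoftmax ((X * WQ) * (X * WK + biasRows n cK)ᵀ + B X) ⊙ C}

/-- `(∫_D ‖f(X) - g(X)‖_p^p dX)^{1/p}` with the entry-wise `ℓ^p` norm and Lebesgue measure on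
`ℝ^{n × d}`, as an extended nonnegative real. -/
def lpDist {n d : ℕ} (p : ℝ) (D : Set (TokenSeq n d)) (f g : TokenSeq n d → TokenSeq n d) : ℝ≥0∞ :=
  (∫⁻ X : Fin n → Fin d → ℝ in Matrix.of ⁻¹' D,
    ENNReal.ofReal (∑ i, ∑ j, |f (Matrix.of X) i j - g (Matrix.of X) i j| ^ p)) ^ (1 / p)

end

/-! ### Transformers built from constant Toeplitz attention and column-wise scalar functions. -/

section RelativePositionalTransformers

variable {n d : ℕ}

/-! With zero queries, keys and encoding, softmax is uniform. Rescaling the Toeplitz factor by `n`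
therefore makes every constant Toeplitz matrix an attention matrix, whatever the form of `B`
(`const_mem_urpeAttention`). Universality uses only such heads, so attention provides fixed linear
mixing and position-dependent shifts. All nonlinearity comes from the ReLU layers.

On a grid, `f` is nearly constant on each cell, and a cell-wise constant function is realized
exactly away from thin gaps between cells (`exists_transformer_of_cells`). Shifting by position puts
the rows in disjoint ranges. A scalar function per column can then replace each entry by its grid
digit, weighted by a power of `N` specific to that entry. All-ones mixing adds these digits into an
integer coding the whole cell. Adding the position makes the entry of each column determine both
cell and row (`tokenIndex_injective`), so a second scalar function per column can look up the
output. These scalar functions are compositions of four-unit ReLU maps, each collapsing one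
interval.

A final clamp bounds the network everywhere, so gaps of small measure contribute little to the `L^p`
error. -/

theorem Transformers.of_mem_TBlocks {𝓐 : AttnClass n d} {H dH r : ℕ} {g : TokenSeq n d → TokenSeq n d}
    (hg : g ∈ TBlocks 𝓐 H dH r) : g ∈ Transformers 𝓐 H dH r :=
  ⟨[g], by simp, by simpa using hg, by simp⟩

theorem Transformers.comp_mem {𝓐 : AttnClass n d} {H dH r : ℕ} {g h : TokenSeq n d → TokenSeq n d}
    (hg : g ∈ Transformers 𝓐 H dH r) (hh : h ∈ Transformers 𝓐 H dH r) :
    g ∘ h ∈ Transformers 𝓐 H dH r := by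
  obtain ⟨l, hl, hlb, rfl⟩ := hg
  obtain ⟨m, -, hmb, rfl⟩ := hh
  refine ⟨l ++ m, by simp [hl], fun b hb => ?_, ?_⟩
  · rcases List.mem_append.1 hb with hb | hb
    exacts [hlb b hb, hmb b hb]
  · clear hl hlb
    induction l with
    | nil => rfl
    | cons a l ih => rw [List.cons_append, List.foldr_cons, List.foldr_cons, ← ih]; rfl

theorem zero_mem_rpeClass (dH : ℕ) (WQ WK : Matrix (Fin d) (Fin dH) ℝ) (form : RPEForm d) :
    (fun _ => 0) ∈ rpeClass n dH WQ WK form := by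
  cases form with
  | shaw => exact ⟨0, by simp⟩
  | t5 => exact ⟨0, by simp⟩
  | deberta => exact ⟨0, 0, by simp⟩
  | transformerXL ρ => exact ⟨0, 0, 0, by simp⟩

/-- The softmax of the zero matrix has all entries `1 / n`, which the factor `n • C` cancels. -/
theorem const_mem_urpeAttention (hn : 0 < n) (form : RPEForm d) (dH : ℕ)
    {C : Matrix (Fin n) (Fin n) ℝ} (hC : IsToeplitz C) :
    (fun _ => C) ∈ urpeAttention n form dH := by
  obtain ⟨t, ht⟩ := hC
  refine ⟨0, 0, 0, fun _ => 0, (n : ℝ) • C, zero_mem_rpeClass _ _ _ _,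
    ⟨fun k => n * t k, fun i j => by simp [ht]⟩, ?_⟩
  funext X
  ext i j
  have : (n : ℝ) ≠ 0 := by positivity
  simp [rowSoftmax]
  field_simp

theorem attentiveCondition_urpeAttention (form : RPEForm d) {dH : ℕ} (hdH : 0 < dH) :
    AttentiveCondition (urpeAttention n form dH) := by
  intro u c
  let k₀ : Fin dH := ⟨0, hdH⟩
  -- Only one coordinate of the head is used, so the inner products of queries and keys reduce to
  -- scalar products.
  let W : Matrix (Fin d) (Fin dH) ℝ := Matrix.of fun l k => if k = k₀ then u l 0 else 0
  have hW : ∀ (X : TokenSeq n d) i k, (X * W) i k = if k = k₀ then (X * u) i 0 else 0 := by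
    intro X i k
    by_cases hk : k = k₀ <;> simp [Matrix.mul_apply, W, hk]
  refine ⟨_, ⟨W, W, fun k => if k = k₀ then -c else 0, fun _ => 0, Matrix.of fun _ _ => 1,
    zero_mem_rpeClass _ _ _ _, ⟨fun _ => 1, fun _ _ => rfl⟩, rfl⟩, fun X => ?_⟩
  have hZ : (X * W) * (X * W + biasRows n fun k => if k = k₀ then -c else 0)ᵀ + 0
      = (X * u) * (X * u - biasRows n fun _ => c)ᵀ := by
    ext i j
    rw [add_zero, Matrix.mul_apply, Matrix.mul_apply]
    simp [hW, biasRows, sub_eq_add_neg]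
  ext i j
  dsimp only
  rw [hZ]
  simp

/-- The Toeplitz matrix with `x` on the diagonal, `y` below it and `0` above it. -/
def lowerToeplitz (n : ℕ) (x y : ℝ) : Matrix (Fin n) (Fin n) ℝ :=
  Matrix.of fun i j => (if j = i then x else 0) + (if j < i then y else 0)

theorem isToeplitz_lowerToeplitz (x y : ℝ) : IsToeplitz (lowerToeplitz n x y) := by
  refine ⟨fun k => (if k = 0 then x else 0) + (if 0 < k then y else 0), fun i j => ?_⟩
  have h₁ : j = i ↔ (i : ℤ) - j = 0 := by rw [Fin.ext_iff]; omega
  have h₂ : j < i ↔ 0 < (i : ℤ) - j := by rw [Fin.lt_def]; omega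
  simp only [lowerToeplitz, Matrix.of_apply, h₁, h₂]

theorem sum_lowerToeplitz (x y : ℝ) (i : Fin n) : ∑ j, lowerToeplitz n x y i j = x + i * y := by
  simp only [lowerToeplitz, Matrix.of_apply, Finset.sum_add_distrib]
  rw [← Finset.sum_filter (fun j => j < i)]
  have : (Finset.univ.filter fun j => j < i) = Finset.Iio i := by ext; simp
  simp [this]

theorem positionAwareCondition_urpeAttention (hn : 0 < n) (form : RPEForm d) (dH : ℕ) :
    PositionAwareCondition (urpeAttention n form dH) := by
  refine ⟨_, const_mem_urpeAttention hn form dH (isToeplitz_lowerToeplitz 1 1),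
    fun i => 1 + i, fun i j h => ?_, fun X => ?_⟩
  · simpa [Fin.ext_iff] using h
  · funext i
    simpa [Matrix.mulVec, dotProduct] using sum_lowerToeplitz 1 1 i

/-- Attention layers realize rank-one token mixing by Toeplitz matrices, together with a
position-dependent bias that is affine in the position. -/
theorem mixing_mem_transformers (hn : 0 < n) (form : RPEForm d)
    {C : Matrix (Fin n) (Fin n) ℝ} (hC : IsToeplitz C) (w v : Fin d → ℝ) (x y : ℝ) :
    (fun X : TokenSeq n d => Matrix.of fun i j =>
      X i j + (∑ k, C i k * ∑ l, X k l * w l) * v j + (x + i * y)) ∈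
      Transformers (urpeAttention n form 1) 2 1 4 := by
  -- The second head ignores `X`: its value vector is the constant `1`, so it outputs the row sums
  -- `x + i * y`. The feed-forward layer is zero.
  refine Transformers.of_mem_TBlocks ⟨![fun _ => C, fun _ => lowerToeplitz n x y],
    ![Matrix.of fun l _ => w l, 0], ![0, 1], ![Matrix.of fun _ j => v j, Matrix.of fun _ _ => 1], 0,
    0, 0, 0, 0, ?_, ?_⟩
  · intro h
    fin_cases h
    · exact const_mem_urpeAttention hn form 1 hC
    · exact const_mem_urpeAttention hn form 1 (isToeplitz_lowerToeplitz x y)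
  · funext X
    ext i j
    simp [ffnLayer, attnLayer, biasRows, Matrix.mul_apply, Fin.sum_univ_two, add_assoc,
      ← sum_lowerToeplitz x y i]

/-- The map that applies `φ j` to every entry of column `j`. -/
def mapCols (φ : Fin d → ℝ → ℝ) (X : TokenSeq n d) : TokenSeq n d :=
  Matrix.of fun i j => φ j (X i j)

/-- The residual ReLU network on the real line with four hidden units. -/
def residualRelu (w b a : Fin 4 → ℝ) (c : ℝ) (x : ℝ) : ℝ :=
  x + ((∑ k, max (x * w k + b k) 0 * a k) + c)

/-- The functions that can be applied to any single column by a Transformer. -/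
def ColumnRealizable (n : ℕ) (form : RPEForm d) (φ : ℝ → ℝ) : Prop :=
  ∀ j : Fin d, mapCols (Function.update (fun _ => id) j φ) ∈
    Transformers (urpeAttention n form 1) 2 1 4

theorem columnRealizable_residualRelu (hn : 0 < n) (form : RPEForm d) (w b a : Fin 4 → ℝ) (c : ℝ) :
    ColumnRealizable n form (residualRelu w b a c) := by
  intro j
  refine Transformers.of_mem_TBlocks ⟨fun _ _ => 0, 0, 0, 0, 0,
    Matrix.of fun l k => if l = j then w k else 0, b, Matrix.of fun k l => if l = j then a k else 0,
    fun l => if l = j then c else 0,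
    fun _ => const_mem_urpeAttention hn form 1 ⟨0, by simp⟩, ?_⟩
  funext X
  ext i l
  by_cases hl : l = j
  · subst hl
    simp [mapCols, ffnLayer, attnLayer, biasRows, Matrix.mul_apply, reluMat, residualRelu]
  · simp [mapCols, ffnLayer, attnLayer, biasRows, Matrix.mul_apply, reluMat, hl]

theorem ColumnRealizable.comp {form : RPEForm d} {φ ψ : ℝ → ℝ} (hφ : ColumnRealizable n form φ)
    (hψ : ColumnRealizable n form ψ) : ColumnRealizable n form (φ ∘ ψ) := by
  intro j
  convert Transformers.comp_mem (hφ j) (hψ j) using 1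
  funext X
  ext i l
  by_cases hl : l = j
  · subst hl; simp [mapCols]
  · simp [mapCols, hl]

theorem columnRealizable_id (hn : 0 < n) (form : RPEForm d) : ColumnRealizable n form id := by
  convert columnRealizable_residualRelu hn form 0 0 0 0
  funext x
  simp [residualRelu]

/-- Columns are treated one after another, since four hidden units serve a single column at a time.
-/
theorem mapCols_mem_transformers (hn : 0 < n) (hd : 0 < d) {form : RPEForm d} {φ : Fin d → ℝ → ℝ}
    (hφ : ∀ j, ColumnRealizable n form (φ j)) :
    mapCols φ ∈ Transformers (urpeAttention n form 1) 2 1 4 := by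
  have key : ∀ s : Finset (Fin d), mapCols (fun j => if j ∈ s then φ j else id) ∈
      Transformers (urpeAttention n form 1) 2 1 4 := by
    intro s
    induction s using Finset.induction_on with
    | empty =>
      have := columnRealizable_id hn form ⟨0, hd⟩
      simpa using this
    | insert j s hj ih =>
      convert Transformers.comp_mem (hφ j j) ih using 1
      funext X
      ext i l
      by_cases hl : l = j
      · subst hl; simp [mapCols, hj]
      · simp [mapCols, hl]
  simpa using key Finset.univ

theorem columnRealizable_clamp (hn : 0 < n) (form : RPEForm d) (K : ℝ) :
    ColumnRealizable n form (fun x => x + (max (-x - K) 0 - max (x - K) 0)) := by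
  convert columnRealizable_residualRelu hn form ![-1, 1, 0, 0] ![-K, -K, 0, 0] ![1, -1, 0, 0] 0
  simp [residualRelu, Fin.sum_univ_four]
  ring_nf

/-- A realizable function that collapses an interval to a point and is the identity away from it. -/
theorem exists_columnRealizable_collapse (hn : 0 < n) (form : RPEForm d) (a b c : ℝ) {η : ℝ}
    (hη : 0 < η) : ∃ φ, ColumnRealizable n form φ ∧ (∀ x ∈ Set.Icc a b, φ x = c) ∧
      ∀ x ∉ Set.Ioo (a - η) (b + η), φ x = x := by
  by_cases hab : a ≤ b
  -- The graph is piecewise linear with kinks at `a - η`, `a`, `b`, `b + η`. The output weights are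
  -- the changes of slope: the ramps join the identity to the constant `c`.
  · refine ⟨_, columnRealizable_residualRelu hn form (fun _ => 1) ![-(a - η), -a, -b, -(b + η)]
      ![(c - a) / η, -1 - (c - a) / η, 1 - (c - b) / η, (c - b) / η] 0, fun x hx => ?_, fun x hx => ?_⟩
    · obtain ⟨h₁, h₂⟩ := hx
      simp only [residualRelu, Fin.sum_univ_four, Matrix.cons_val]
      rw [max_eq_left (by linarith), max_eq_left (by linarith), max_eq_right (by linarith),
        max_eq_right (by linarith)]
      field_simp
      ring
    · rcases le_or_gt x (a - η) with h | h
      · simp only [residualRelu, Fin.sum_univ_four, Matrix.cons_val]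
        rw [max_eq_right (by linarith), max_eq_right (by linarith), max_eq_right (by linarith),
          max_eq_right (by linarith)]
        ring
      · have h' : b + η ≤ x := not_lt.1 fun h' => hx ⟨h, h'⟩
        simp only [residualRelu, Fin.sum_univ_four, Matrix.cons_val]
        rw [max_eq_left (by linarith), max_eq_left (by linarith), max_eq_left (by linarith),
          max_eq_left (by linarith)]
        field_simp
        ring
  · exact ⟨id, columnRealizable_id hn form, fun x hx => absurd (hx.1.trans hx.2) hab, fun _ _ => rfl⟩

/-- A realizable function with prescribed constant values on finitely many separated intervals. -/
theorem exists_columnRealizable_piecewise (hn : 0 < n) (form : RPEForm d) {ι : Type*} [Fintype ι]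
    (a b c : ι → ℝ) {η : ℝ} (hη : 0 < η)
    (hsep : ∀ k l, k ≠ l → ∀ x ∈ Set.Icc (a k) (b k), x ∉ Set.Ioo (a l - η) (b l + η))
    (hc : ∀ k l, c k ∉ Set.Ioo (a l - η) (b l + η)) :
    ∃ φ, ColumnRealizable n form φ ∧ ∀ k, ∀ x ∈ Set.Icc (a k) (b k), φ x = c k := by
  classical
  -- Intervals are collapsed one by one. Being the identity off the neighbourhoods already treated
  -- keeps the remaining intervals in place, and no later collapse moves a value already assigned.
  have key : ∀ s : Finset ι, ∃ φ, ColumnRealizable n form φ ∧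
      (∀ k ∈ s, ∀ x ∈ Set.Icc (a k) (b k), φ x = c k) ∧
      ∀ x, (∀ k ∈ s, x ∉ Set.Ioo (a k - η) (b k + η)) → φ x = x := by
    intro s
    induction s using Finset.induction_on with
    | empty => exact ⟨id, columnRealizable_id hn form, by simp, by simp⟩
    | insert l s hl ih =>
      obtain ⟨φ, hφ, hφc, hφi⟩ := ih
      obtain ⟨ψ, hψ, hψc, hψi⟩ := exists_columnRealizable_collapse hn form (a l) (b l) (c l) hη
      refine ⟨ψ ∘ φ, hψ.comp hφ, fun k hk x hx => ?_, fun x hx => ?_⟩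
      · rcases Finset.mem_insert.1 hk with rfl | hk
        · rw [Function.comp_apply, hφi x fun m hm => hsep k m (by rintro rfl; exact hl hm) x hx,
            hψc x hx]
        · rw [Function.comp_apply, hφc k hk x hx, hψi _ (hc k l)]
      · rw [Function.comp_apply, hφi x fun k hk => hx k (Finset.mem_insert_of_mem hk),
          hψi x (hx l (Finset.mem_insert_self l s))]
  obtain ⟨φ, hφ, hφc, -⟩ := key Finset.univ
  exact ⟨φ, hφ, fun k => hφc k (Finset.mem_univ k)⟩

end RelativePositionalTransformers

/-! ### Coding grid cells by integers and realizing cell-wise constant functions. -/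

section CellwiseConstant

variable {n d : ℕ}

/-- The index of a grid cell of `ℝ^{n × d}` with `N` cells in each coordinate. -/
def cellIndex {N : ℕ} (κ : Fin n × Fin d → Fin N) : ℕ :=
  finFunctionFinEquiv fun t => κ (finProdFinEquiv.symm t)

theorem cellIndex_lt {N : ℕ} (κ : Fin n × Fin d → Fin N) : cellIndex κ < N ^ (n * d) :=
  (finFunctionFinEquiv fun t => κ (finProdFinEquiv.symm t)).isLt

theorem cellIndex_injective {N : ℕ} :
    Function.Injective (cellIndex : (Fin n × Fin d → Fin N) → ℕ) := by
  intro κ κ' h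
  have h' := finFunctionFinEquiv.injective (Fin.ext h)
  funext p
  simpa using congrFun h' (finProdFinEquiv p)

theorem cellIndex_eq_sum {N : ℕ} (κ : Fin n × Fin d → Fin N) :
    cellIndex κ = ∑ i, ∑ j, (κ (i, j) : ℕ) * N ^ (finProdFinEquiv (i, j) : ℕ) := by
  rw [cellIndex, finFunctionFinEquiv_apply, ← Fintype.sum_prod_type',
    ← Equiv.sum_comp finProdFinEquiv]
  simp

theorem digit_le_cellIndex {N : ℕ} (κ : Fin n × Fin d → Fin N) (i : Fin n) (j : Fin d) :
    (κ (i, j) : ℕ) * N ^ (finProdFinEquiv (i, j) : ℕ) ≤ cellIndex κ := by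
  rw [cellIndex_eq_sum, ← Fintype.sum_prod_type']
  exact Finset.single_le_sum
    (f := fun p : Fin n × Fin d => (κ p : ℕ) * N ^ (finProdFinEquiv p : ℕ))
    (fun _ _ => Nat.zero_le _) (Finset.mem_univ (i, j))

/-- An integer that identifies both a grid cell and the position of a token. -/
def tokenIndex {N : ℕ} (j : Fin d) (q : Fin n × (Fin n × Fin d → Fin N)) : ℕ :=
  (q.1 * N ^ (n * d) + cellIndex q.2) * N ^ (n * d) +
    q.2 (q.1, j) * N ^ (finProdFinEquiv (q.1, j) : ℕ)

theorem eq_and_eq_of_mul_add_eq {B a b a' b' : ℕ} (hb : b < B) (hb' : b' < B)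
    (h : a * B + b = a' * B + b') : a = a' ∧ b = b' := by
  have hB : 0 < B := by omega
  have h₁ : (a * B + b) / B = a := by
    rw [mul_comm, Nat.mul_add_div hB, Nat.div_eq_of_lt hb, add_zero]
  have h₂ : (a' * B + b') / B = a' := by
    rw [mul_comm, Nat.mul_add_div hB, Nat.div_eq_of_lt hb', add_zero]
  have h₃ : a = a' := by rw [← h₁, ← h₂, h]
  subst h₃
  exact ⟨rfl, by omega⟩

/-- The last summand is the entry's own digit, which the skip connection leaves behind. It is at
most `cellIndex`, hence below the base `N ^ (n * d)`, so two divisions with remainder recover the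
cell and the row. -/
theorem tokenIndex_injective {N : ℕ} (j : Fin d) :
    Function.Injective (tokenIndex j : Fin n × (Fin n × Fin d → Fin N) → ℕ) := by
  rintro ⟨i, κ⟩ ⟨i', κ'⟩ h
  have h₁ := eq_and_eq_of_mul_add_eq ((digit_le_cellIndex κ i j).trans_lt (cellIndex_lt κ))
    ((digit_le_cellIndex κ' i' j).trans_lt (cellIndex_lt κ')) h
  have h₂ := eq_and_eq_of_mul_add_eq (cellIndex_lt κ) (cellIndex_lt κ') h₁.1
  exact Prod.ext (Fin.ext h₂.1) (cellIndex_injective h₂.2)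

theorem add_one_le_or_of_ne {a b : ℕ} (h : a ≠ b) : (a : ℝ) + 1 ≤ b ∨ (b : ℝ) + 1 ≤ a := by
  rcases h.lt_or_gt with h | h
  · left; exact_mod_cast h
  · right; exact_mod_cast h

/-- Realizable functions that map shrunken consecutive cells of a grid on the negative half-line
to prescribed nonnegative values. -/
theorem exists_columnRealizable_quantize (hn : 0 < n) (form : RPEForm d) (M : ℕ) {δ η : ℝ}
    (hδ : 0 < δ) (hη : 0 < η) (c : Fin M → ℝ) (hc : ∀ m, 0 ≤ c m) :
    ∃ φ, ColumnRealizable n form φ ∧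
      ∀ m : Fin M, ∀ x ∈ Set.Icc ((m - M) * δ + η) ((m + 1 - M) * δ - η), φ x = c m := by
  refine exists_columnRealizable_piecewise hn form _ _ c hη (fun k l hkl x hx hx' => ?_)
    (fun k l h => ?_)
  · obtain ⟨h₁, h₂⟩ := hx
    obtain ⟨h₃, h₄⟩ := hx'
    rcases add_one_le_or_of_ne (Fin.val_ne_of_ne hkl) with h | h
    · have := mul_le_mul_of_nonneg_right h hδ.le
      linarith
    · have := mul_le_mul_of_nonneg_right h hδ.le
      linarith
  -- The enlarged intervals stay on the negative half-line, so nonnegative values avoid them.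
  · have h₁ : (l : ℝ) + 1 ≤ M := by exact_mod_cast l.isLt
    have h₂ := mul_le_mul_of_nonneg_right h₁ hδ.le
    have h₃ := hc k
    have h₄ := h.2
    linarith

/-- Realizable functions interpolating prescribed values at finitely many points of the lattice
`ℕ + s`, if the values lie below that lattice. -/
theorem exists_columnRealizable_interpolate (hn : 0 < n) (form : RPEForm d) {ι : Type*} [Fintype ι]
    {m : ι → ℕ} (hm : Function.Injective m) (s : ℝ) (c : ι → ℝ) (hc : ∀ k, c k ≤ s - 1) :
    ∃ φ, ColumnRealizable n form φ ∧ ∀ k, φ (m k + s) = c k := by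
  have hsep : ∀ k l, k ≠ l → ∀ x ∈ Set.Icc ((m k : ℝ) + s) (m k + s),
      x ∉ Set.Ioo ((m l : ℝ) + s - 1 / 2) (m l + s + 1 / 2) := by
    rintro k l hkl x ⟨h₁, h₂⟩ ⟨h₃, h₄⟩
    rcases add_one_le_or_of_ne (hm.ne hkl) with h | h <;> linarith
  have hlow : ∀ k l, c k ∉ Set.Ioo ((m l : ℝ) + s - 1 / 2) (m l + s + 1 / 2) := by
    rintro k l ⟨h₁, -⟩
    have h₂ := hc k
    have h₃ : (0 : ℝ) ≤ m l := Nat.cast_nonneg _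
    linarith
  obtain ⟨φ, hφ, h⟩ := exists_columnRealizable_piecewise hn form _ _ c one_half_pos hsep hlow
  exact ⟨φ, hφ, fun k => h k _ ⟨le_rfl, le_rfl⟩⟩

/-- Transformers realize, exactly and with a bound, any function that is constant on each of the
shrunken cells of a finite grid. -/
theorem exists_transformer_of_cells (hn : 0 < n) (hd : 0 < d) (form : RPEForm d) (N : ℕ) (o : ℝ)
    {δ η K : ℝ} (hδ : 0 < δ) (hη : 0 < η) (hK : 0 ≤ K)
    (y : (Fin n × Fin d → Fin N) → Fin n → Fin d → ℝ) (hy : ∀ κ i j, |y κ i j| ≤ K) :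
    ∃ g ∈ Transformers (urpeAttention n form 1) 2 1 4, (∀ X i j, |g X i j| ≤ K) ∧
      ∀ (κ : Fin n × Fin d → Fin N) (X : TokenSeq n d),
        (∀ i j, X i j ∈ Set.Icc (o + κ (i, j) * δ + η) (o + (κ (i, j) + 1) * δ - η)) →
        ∀ i j, g X i j = y κ i j := by
  have hones : IsToeplitz (Matrix.of fun _ _ : Fin n => (1 : ℝ)) := ⟨fun _ => 1, fun _ _ => rfl⟩
  -- This shift moves row `i` to the range from `(i - n) * N * δ` to `(i + 1 - n) * N * δ`, leaving
  -- the target half-line free for the digits.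
  have hpos := mixing_mem_transformers hn form hones 0 0 (-(o + n * N * δ)) (N * δ)
  -- The scales `N ^ (n * d)` and its square separate digit, cell index and position. The offset `K
  -- + 1` places the codes at least `1` above all target values, as interpolation requires.
  have hmix := mixing_mem_transformers hn form hones (fun _ => 1)
    (fun _ => (N : ℝ) ^ (n * d)) (K + 1) ((N : ℝ) ^ (n * d) * (N : ℝ) ^ (n * d))
  choose q hq hqc using fun j : Fin d => exists_columnRealizable_quantize hn form (n * N) hδ hη
    (fun m => ((finProdFinEquiv.symm m).2 : ℝ) *
      (N : ℝ) ^ (finProdFinEquiv ((finProdFinEquiv.symm m).1, j) : ℕ)) (fun m => by positivity)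
  choose φ hφ hφc using fun j : Fin d => exists_columnRealizable_interpolate hn form
    (tokenIndex_injective (n := n) (N := N) j) (K + 1) (fun q => y q.2 q.1 j)
    (fun q => by have := (abs_le.1 (hy q.2 q.1 j)).2; linarith)
  refine ⟨_, Transformers.comp_mem
    (mapCols_mem_transformers hn hd fun _ => columnRealizable_clamp hn form K)
    (Transformers.comp_mem (mapCols_mem_transformers hn hd hφ) (Transformers.comp_mem hmix
      (Transformers.comp_mem (mapCols_mem_transformers hn hd hq) hpos))), fun X i j => ?_, fun κ X hX i j => ?_⟩
  · simp only [Function.comp_apply]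
    rw [mapCols, Matrix.of_apply]
    generalize mapCols φ _ i j = t
    rw [abs_le]
    constructor
    · rcases max_cases (-t - K) 0 with h | h <;> rcases max_cases (t - K) 0 with h' | h' <;> linarith
    · rcases max_cases (-t - K) 0 with h | h <;> rcases max_cases (t - K) 0 with h' | h' <;> linarith
  · have hquant : ∀ k l, q l (X k l + (-(o + n * N * δ) + k * (N * δ))) =
        κ (k, l) * (N : ℝ) ^ (finProdFinEquiv (k, l) : ℕ) := by
      intro k l
      obtain ⟨h₁, h₂⟩ := hX k l
      -- The number of this interval is `κ (k, l) + N * k`: the cell of the entry within the block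
      -- of row `k`.
      rw [hqc l (finProdFinEquiv (k, κ (k, l)))]
      · simp
      · simp only [finProdFinEquiv_apply_val]
        push_cast
        constructor <;> linarith
    have hsum : ∑ k, ∑ l, (κ (k, l) : ℝ) * (N : ℝ) ^ (finProdFinEquiv (k, l) : ℕ) = cellIndex κ := by
      rw [cellIndex_eq_sum]
      push_cast
      rfl
    have hval : φ j (tokenIndex j (i, κ) + (K + 1)) = y κ i j := hφc j (i, κ)
    have hid : (κ (i, j) : ℝ) * (N : ℝ) ^ (finProdFinEquiv (i, j) : ℕ) +
        cellIndex κ * (N : ℝ) ^ (n * d) +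
          (K + 1 + i * ((N : ℝ) ^ (n * d) * (N : ℝ) ^ (n * d))) = tokenIndex j (i, κ) + (K + 1) := by
      simp only [tokenIndex]
      push_cast
      ring
    simp only [Function.comp_apply, mapCols, Matrix.of_apply, Pi.zero_apply, mul_zero, add_zero,
      mul_one, one_mul, hquant, hsum]
    rw [hid, hval, max_eq_right (by linarith [(abs_le.1 (hy κ i j)).1]),
      max_eq_right (by linarith [(abs_le.1 (hy κ i j)).2])]
    ring

end CellwiseConstant

/-! ### Small gaps and the passage to `L^p` approximation. -/

section LpApproximation

open MeasureTheory Filter Topology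

variable {n d : ℕ}

/-- The points with some coordinate outside all shrunken cells of a grid. -/
def gridGap (n d N : ℕ) (o δ η : ℝ) : Set (Fin n → Fin d → ℝ) :=
  {X | ∃ i j, ∀ k : Fin N, X i j ∉ Set.Icc (o + k * δ + η) (o + (k + 1) * δ - η)}

theorem measurableSet_gridGap (N : ℕ) (o δ η : ℝ) : MeasurableSet (gridGap n d N o δ η) := by
  simp only [gridGap, Set.ofPred_exists, Set.ofPred_forall]
  refine MeasurableSet.iUnion fun i => MeasurableSet.iUnion fun j => MeasurableSet.iInter fun k => ?_
  exact (measurableSet_Icc.preimage (by fun_prop : Measurable fun X : Fin n → Fin d → ℝ => X i j)).compl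

theorem gridGap_mono (N : ℕ) (o δ : ℝ) {η η' : ℝ} (h : η ≤ η') :
    gridGap n d N o δ η ⊆ gridGap n d N o δ η' := by
  rintro X ⟨i, j, hX⟩
  exact ⟨i, j, fun k hk => hX k ⟨by linarith [hk.1], by linarith [hk.2]⟩⟩

theorem volume_setOf_entry_eq (i : Fin n) (j : Fin d) (c : ℝ) :
    volume {X : Fin n → Fin d → ℝ | X i j = c} = 0 := by
  have h₁ : volume {v : Fin d → ℝ | v j = c} = 0 :=
    Measure.pi_hyperplane (fun _ : Fin d => (volume : Measure ℝ)) j c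
  exact (Measure.quasiMeasurePreserving_eval (fun _ : Fin n => (volume : Measure (Fin d → ℝ))) i).preimage_null
    h₁

/-- On a bounded set covered by a grid, the gaps between the shrunken cells have small measure. -/
theorem exists_volume_gridGap_lt {D : Set (Fin n → Fin d → ℝ)} (hDm : MeasurableSet D)
    (hDf : volume D ≠ ∞) {N : ℕ} {o δ : ℝ} (hδ : 0 < δ)
    (hD : ∀ X ∈ D, ∀ i j, o ≤ X i j ∧ X i j < o + N * δ) {τ : ℝ≥0∞} (hτ : 0 < τ) :
    ∃ η : ℝ, 0 < η ∧ volume (gridGap n d N o δ η ∩ D) < τ := by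
  have hanti : Antitone fun m : ℕ => gridGap n d N o δ (1 / ((m : ℝ) + 1)) ∩ D := fun a b hab =>
    Set.inter_subset_inter_left _ (gridGap_mono _ _ _ (one_div_le_one_div_of_le (by positivity)
      (by simpa using hab)))
  have hlim := tendsto_measure_iInter_atTop (μ := volume)
    (fun m : ℕ => ((measurableSet_gridGap N o δ (1 / ((m : ℝ) + 1))).inter hDm).nullMeasurableSet) hanti
    ⟨0, measure_ne_top_of_subset Set.inter_subset_right hDf⟩
  -- A point of `D` off the countably many grid hyperplanes is strictly inside a cell in every
  -- coordinate, so it leaves the gaps once `1 / (m + 1)` is small.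
  have hnull : volume (⋂ m : ℕ, gridGap n d N o δ (1 / ((m : ℝ) + 1)) ∩ D) = 0 := by
    refine measure_mono_null (t := ⋃ (i : Fin n) (j : Fin d) (k : ℕ), {X | X i j = o + k * δ}) ?_
      (measure_iUnion_null fun i => measure_iUnion_null fun j => measure_iUnion_null fun k =>
        volume_setOf_entry_eq i j _)
    intro X hX
    by_contra hne
    simp only [Set.mem_iUnion, Set.mem_ofPred_eq, not_exists] at hne
    simp only [Set.mem_iInter, Set.mem_inter_iff] at hX
    have hXD := (hX 0).2
    have hcell : ∀ i j, ∃ k : Fin N, o + k * δ < X i j ∧ X i j < o + (k + 1) * δ := by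
      intro i j
      obtain ⟨h₁, h₂⟩ := hD X hXD i j
      have h₃ : 0 ≤ (X i j - o) / δ := div_nonneg (by linarith) hδ.le
      refine ⟨⟨⌊(X i j - o) / δ⌋₊, ?_⟩, ?_, ?_⟩
      · rw [Nat.floor_lt h₃, div_lt_iff₀ hδ]
        linarith
      · have := (le_div_iff₀ hδ).1 (Nat.floor_le h₃)
        exact lt_of_le_of_ne (by simp only; linarith) (Ne.symm (hne i j _))
      · have := (div_lt_iff₀ hδ).1 (Nat.lt_floor_add_one ((X i j - o) / δ))
        simp only
        linarith
    choose k hk using hcell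
    have hev : ∀ᶠ m : ℕ in atTop, ∀ i j, 1 / ((m : ℝ) + 1) < X i j - (o + k i j * δ) ∧
        1 / ((m : ℝ) + 1) < o + (k i j + 1) * δ - X i j := by
      simp only [eventually_all, eventually_and]
      exact fun i j => ⟨(tendsto_one_div_add_atTop_nhds_zero_nat (𝕜 := ℝ)).eventually_lt_const
          (by linarith [(hk i j).1]),
        (tendsto_one_div_add_atTop_nhds_zero_nat (𝕜 := ℝ)).eventually_lt_const
          (by linarith [(hk i j).2])⟩
    obtain ⟨m, hm⟩ := hev.exists
    obtain ⟨i, j, hij⟩ := (hX m).1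
    exact hij (k i j) ⟨by linarith [(hm i j).1], by linarith [(hm i j).2]⟩
  rw [hnull] at hlim
  obtain ⟨m, hm⟩ := (hlim.eventually_lt_const hτ).exists
  exact ⟨1 / ((m : ℝ) + 1), by positivity, hm⟩

/-- An `L^p` distance is small if the entry-wise distance is small off a set of small measure and
bounded on that set. -/
theorem lpDist_lt_of_bounds {p ε s b : ℝ} (hp : 0 < p) (hε : 0 < ε)
    {D : Set (TokenSeq n d)} {E : Set (Fin n → Fin d → ℝ)} (hDm : MeasurableSet (Matrix.of ⁻¹' D))
    (hE : MeasurableSet E) {f g : TokenSeq n d → TokenSeq n d}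
    (hgood : ∀ X ∈ D, Matrix.of.symm X ∉ E → ∀ i j, |f X i j - g X i j| ≤ s)
    (hbad : ∀ X ∈ D, ∀ i j, |f X i j - g X i j| ≤ b)
    (hlt : ENNReal.ofReal (n * d * s ^ p) * volume (Matrix.of ⁻¹' D) +
      ENNReal.ofReal (n * d * b ^ p) * volume (E ∩ Matrix.of ⁻¹' D) < ENNReal.ofReal (ε ^ p)) :
    lpDist p D f g < ENNReal.ofReal ε := by
  have hsum : ∀ (X : TokenSeq n d) {t : ℝ}, (∀ i j, |f X i j - g X i j| ≤ t) →
      ∑ i, ∑ j, |f X i j - g X i j| ^ p ≤ n * d * t ^ p := by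
    intro X t ht
    calc ∑ i, ∑ j, |f X i j - g X i j| ^ p ≤ ∑ _i : Fin n, ∑ _j : Fin d, t ^ p :=
          Finset.sum_le_sum fun i _ => Finset.sum_le_sum fun j _ =>
            Real.rpow_le_rpow (abs_nonneg _) (ht i j) hp.le
      _ = n * d * t ^ p := by simp [mul_assoc]
  have hint : (∫⁻ X : Fin n → Fin d → ℝ in Matrix.of ⁻¹' D,
      ENNReal.ofReal (∑ i, ∑ j, |f (Matrix.of X) i j - g (Matrix.of X) i j| ^ p)) ≤
      ENNReal.ofReal (n * d * s ^ p) * volume (Matrix.of ⁻¹' D) +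
        ENNReal.ofReal (n * d * b ^ p) * volume (E ∩ Matrix.of ⁻¹' D) := by
    calc _ ≤ ∫⁻ X : Fin n → Fin d → ℝ in Matrix.of ⁻¹' D, (ENNReal.ofReal (n * d * s ^ p) +
          E.indicator (fun _ => ENNReal.ofReal (n * d * b ^ p)) X) := by
          refine setLIntegral_mono' hDm fun X hX => ?_
          by_cases hXE : X ∈ E
          · rw [Set.indicator_of_mem hXE]
            exact (ENNReal.ofReal_le_ofReal (hsum _ (hbad _ hX))).trans le_add_self
          · exact (ENNReal.ofReal_le_ofReal (hsum _ (hgood _ hX hXE))).trans le_self_add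
      _ = _ := by
          rw [lintegral_add_left measurable_const, lintegral_indicator_const hE,
            setLIntegral_const, Measure.restrict_apply hE]
  calc lpDist p D f g ≤ _ := ENNReal.rpow_le_rpow hint (by positivity)
    _ < ENNReal.ofReal (ε ^ p) ^ (1 / p) := ENNReal.rpow_lt_rpow hlt (by positivity)
    _ = ENNReal.ofReal ε := by
        rw [ENNReal.ofReal_rpow_of_nonneg (by positivity) (by positivity), ← Real.rpow_mul hε.le,
          mul_one_div_cancel hp.ne', Real.rpow_one]

theorem exists_transformer_lpDist_lt (hn : 0 < n) (hd : 0 < d) (form : RPEForm d) {p ε : ℝ}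
    (hp : 0 < p) (hε : 0 < ε) {D : Set (TokenSeq n d)} (hD : IsCompact D)
    {f : TokenSeq n d → TokenSeq n d} (hf : ContinuousOn f D) :
    ∃ g ∈ Transformers (urpeAttention n form 1) 2 1 4, lpDist p D f g < ENNReal.ofReal ε := by
  let D' : Set (Fin n → Fin d → ℝ) := Matrix.of ⁻¹' D
  let F : (Fin n → Fin d → ℝ) → Fin n → Fin d → ℝ := f
  have hD' : IsCompact D' := hD
  have hF : ContinuousOn F D' := hf
  obtain ⟨R, hR⟩ := hD'.isBounded.exists_norm_le
  obtain ⟨K₀, hK₀⟩ := (hD'.image_of_continuousOn hF).isBounded.exists_norm_le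
  have hentry : ∀ (X : Fin n → Fin d → ℝ) i j, |X i j| ≤ ‖X‖ := fun X i j =>
    (norm_le_pi_norm (X i) j).trans (norm_le_pi_norm X i)
  set K := max K₀ 0 with hK
  have hfK : ∀ X ∈ D', ∀ i j, |F X i j| ≤ K := fun X hX i j =>
    (hentry _ i j).trans ((hK₀ _ (Set.mem_image_of_mem F hX)).trans (le_max_left _ _))
  have hvol : volume D' ≠ ∞ := hD'.measure_lt_top.ne
  have hεp : 0 < ε ^ p := Real.rpow_pos_of_pos hε p
  -- the accuracy on the cells
  obtain ⟨s, hs, hsV⟩ : ∃ s : ℝ, 0 < s ∧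
      ENNReal.ofReal (n * d * s ^ p) * volume D' < ENNReal.ofReal (ε ^ p) := by
    set V := (volume D').toReal
    have hden : 0 < n * d * (V + 1) := by positivity
    -- Chosen so that `n * d * s ^ p = ε ^ p / (V + 1)`; the `1` allows `V = 0` and makes the bound
    -- strict.
    refine ⟨(ε ^ p / (n * d * (V + 1))) ^ (1 / p), by positivity, ?_⟩
    rw [← Real.rpow_mul (by positivity), one_div_mul_cancel hp.ne', Real.rpow_one,
      ← ENNReal.ofReal_toReal hvol, ← ENNReal.ofReal_mul (by positivity)]
    refine (ENNReal.ofReal_lt_ofReal_iff hεp).2 ?_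
    have : n * d * (ε ^ p / (n * d * (V + 1))) * V = ε ^ p * (V / (V + 1)) := by
      field_simp
    rw [this]
    refine mul_lt_of_lt_one_right hεp ((div_lt_one (by positivity)).2 (by linarith))
  obtain ⟨δ₀, hδ₀, hunif⟩ := Metric.uniformContinuousOn_iff.1
    (hD'.uniformContinuousOn_of_continuous hF) s hs
  set δ := δ₀ / 2 with hδ_def
  have hδ : 0 < δ := half_pos hδ₀
  obtain ⟨N, hN⟩ := exists_nat_gt (2 * R / δ)
  have hgrid : ∀ X ∈ D', ∀ i j, -R ≤ X i j ∧ X i j < -R + N * δ := by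
    intro X hX i j
    have h₁ := abs_le.1 ((hentry X i j).trans (hR X hX))
    have h₂ := (div_lt_iff₀ hδ).1 hN
    constructor <;> linarith
  -- the measure of the gaps
  obtain ⟨τ, hτ, hτlt⟩ : ∃ τ : ℝ≥0∞, 0 < τ ∧ ENNReal.ofReal (n * d * s ^ p) * volume D' +
      ENNReal.ofReal (n * d * (2 * K) ^ p) * τ < ENNReal.ofReal (ε ^ p) := by
    have hlim : Tendsto (fun τ : ℝ≥0∞ => ENNReal.ofReal (n * d * s ^ p) * volume D' +
        ENNReal.ofReal (n * d * (2 * K) ^ p) * τ) (𝓝[>] 0)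
        (𝓝 (ENNReal.ofReal (n * d * s ^ p) * volume D' +
          ENNReal.ofReal (n * d * (2 * K) ^ p) * 0)) :=
      (tendsto_const_nhds.add (ENNReal.Tendsto.const_mul tendsto_id
        (Or.inr ENNReal.ofReal_ne_top))).mono_left nhdsWithin_le_nhds
    rw [mul_zero, add_zero] at hlim
    obtain ⟨τ, hτ, hτ'⟩ := ((hlim.eventually_lt_const hsV).and self_mem_nhdsWithin).exists
    exact ⟨τ, hτ', hτ⟩
  obtain ⟨η, hη, hgap⟩ := exists_volume_gridGap_lt hD'.measurableSet hvol hδ hgrid hτ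
  -- the values on the cells
  let cell : (Fin n × Fin d → Fin N) → Set (Fin n → Fin d → ℝ) := fun κ =>
    {X | X ∈ D' ∧ ∀ i j, X i j ∈ Set.Icc (-R + κ (i, j) * δ + η) (-R + (κ (i, j) + 1) * δ - η)}
  have hval : ∀ κ, ∃ y : Fin n → Fin d → ℝ, (∀ i j, |y i j| ≤ K) ∧
      ∀ X ∈ cell κ, ∀ i j, |F X i j - y i j| ≤ s := by
    intro κ
    -- The value on a cell is that of `F` at a sample point of `D'` in it; an empty cell gets `0`,
    -- which also respects the bound `K`.
    rcases (cell κ).eq_empty_or_nonempty with h | ⟨Y, hYD, hY⟩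
    · exact ⟨0, by simp [hK], by simp [h]⟩
    · refine ⟨F Y, hfK Y hYD, fun X hX i j => ?_⟩
      have hdist : dist X Y < δ₀ := by
        refine lt_of_le_of_lt (b := δ) ?_ (half_lt_self hδ₀)
        refine (dist_pi_le_iff hδ.le).2 fun i => (dist_pi_le_iff hδ.le).2 fun j => ?_
        obtain ⟨h₁, h₂⟩ := hX.2 i j
        obtain ⟨h₃, h₄⟩ := hY i j
        rw [Real.dist_eq, abs_le]
        constructor <;> linarith
      have := hunif X hX.1 Y hYD hdist
      rw [dist_eq_norm] at this
      exact (hentry (F X - F Y) i j).trans this.le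
  choose y hyK hys using hval
  obtain ⟨g, hg, hgK, hgy⟩ := exists_transformer_of_cells hn hd form N (-R) hδ hη
    (le_max_right K₀ 0) y hyK
  -- In the gaps only the bound by `K` on both functions is available, hence `2 * K`.
  refine ⟨g, hg, lpDist_lt_of_bounds hp hε hD'.measurableSet
    (measurableSet_gridGap N (-R) δ η) (s := s) (b := 2 * K) (fun X hX hXE i j => ?_)
    (fun X hX i j => ?_) (lt_of_le_of_lt (by gcongr) hτlt)⟩
  · have hex : ∀ q : Fin n × Fin d, ∃ k : Fin N,
        X q.1 q.2 ∈ Set.Icc (-R + k * δ + η) (-R + (k + 1) * δ - η) := by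
      intro q
      by_contra! hq
      exact hXE ⟨q.1, q.2, hq⟩
    choose κ hκ using hex
    rw [hgy κ X (fun i j => hκ (i, j)) i j]
    exact hys κ X ⟨hX, fun i j => hκ (i, j)⟩ i j
  · have h₁ := abs_le.1 (hfK X hX i j)
    have h₂ := abs_le.1 (hgK X i j)
    change |F X i j - g X i j| ≤ 2 * K
    rw [abs_le]
    constructor <;> linarith

end LpApproximation

theorem mainTheorem3 (n d : ℕ) (hn : 0 < n) (hd : 0 < d) (form : RPEForm d) :
    (∀ dH : ℕ, 0 < dH →
      AttentiveCondition (urpeAttention n form dH) ∧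
      PositionAwareCondition (urpeAttention n form dH)) ∧
    (∀ p : ℝ, 1 ≤ p → ∀ ε : ℝ, 0 < ε →
      ∀ D : Set (TokenSeq n d), IsCompact D →
      ∀ f : TokenSeq n d → TokenSeq n d, ContinuousOn f D →
      ∃ g ∈ Transformers (urpeAttention n form 1) 2 1 4,
        lpDist p D f g < ENNReal.ofReal ε) :=
  ⟨fun dH hdH => ⟨attentiveCondition_urpeAttention form hdH,
      positionAwareCondition_urpeAttention hn form dH⟩,
    fun _ hp _ hε _ hD _ hf => exists_transformer_lpDist_lt hn hd form (one_pos.trans_le hp) hε hD hf⟩
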